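/- Let $I=[a,b]\subset\mathbb{R}$ with $a<b$. Let $\mathcal{K}(\mathbb{R})$ be the set of nonempty compact subsets of $\mathbb{R}$ with the Hausdorff distance $\mathfrak{H}$, and let $\mathcal{K}_c(\mathbb{R})\subset\mathcal{K}(\mathbb{R})$ be the subset of convex ones. Let $\mathcal{C}(I,\mathcal{K}_c(\mathbb{R}))$ be the set of continuous functions $I\to\mathcal{K}_c(\mathbb{R})$. For such a function $f$ let $\mathcal{G}_*(f)=\{(x,f(x)):x\in I\}\subset I\times\mathcal{K}(\mathbb{R})$ be its graph, with the metric $d((x,A),(y,B))=|x-y|+\mathfrak{H}(A,B)$, and let $\dim_H$ denote Hausdorff dimension. For $A,B\in\mathcal{K}(\mathbb{R})$ the metric sum is $$A\oplus B=\{u+v:\ u\in A,\ v\in B,\ |u-v|=\min_{u'\in A}|u'-v|\ \text{ or }\ |u-v|=\min_{v'\in B}|u-v'|\}.$$ For $\beta>1$ let $\mathcal{D}_\beta=\{f\in\mathcal{C}(I,\mathcal{K}_c(\mathbb{R})):\dim_H\mathcal{G}_*(f)=\beta\}$. Theorem. Let $\beta>1$ be a real number and let $f\in\mathcal{C}(I,\mathcal{K}_c(\mathbb{R}))$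 satisfy $\dim_H\mathcal{G}_*(f)\ge\beta$. Then there exist $g_*,h_*\in\mathcal{D}_\beta$ such that $f=g_*\oplus h_*$, that is, $f(x)=g_*(x)\oplus h_*(x)$ for every $x\in I$. -/

import Mathlib

open Set TopologicalSpace

/-- The set `Λ(A, B)` of metric pairs of `A` and `B`: the pairs `(a, b) ∈ A × B` such that
`a` is a point of `A` nearest to `b`, or `b` is a point of `B` nearest to `a`. -/
def metricPairs (A B : Set ℝ) : Set (ℝ × ℝ) :=
  {p | p.1 ∈ A ∧ p.2 ∈ B ∧
    (Metric.infDist p.2 A = |p.2 - p.1| ∨ Metric.infDist p.1 B = |p.1 - p.2|)}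

/-- The metric sum `A ⊕ B = {a + b : (a, b) ∈ Λ(A, B)}`. -/
def metricSum (A B : Set ℝ) : Set ℝ :=
  (fun p : ℝ × ℝ => p.1 + p.2) '' metricPairs A B

/-- `K_c(ℝ)`: the nonempty convex compact subsets of `ℝ`, with the Hausdorff distance
(inherited from `NonemptyCompacts ℝ`). -/
abbrev ConvexCompacts : Type :=
  {A : NonemptyCompacts ℝ // Convex ℝ (A : Set ℝ)}

/-- The graph `G_*(f) = {(x, f(x)) : x ∈ I}` of a set-valued function on `I = [a, b]`, as a subset
of `I × K(ℝ)` with the metric `d((x, A), (y, B)) = |x - y| + H(A, B)`, where `H` is the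
Hausdorff distance. -/
def svfGraph {a b : ℝ} (f : Icc a b → ConvexCompacts) :
    Set (WithLp 1 (Icc a b × NonemptyCompacts ℝ)) :=
  range fun x => WithLp.toLp 1 (x, (f x).1)

/-- `D_β`: the continuous `f : [a, b] → K_c(ℝ)` whose graph has Hausdorff dimension `β`. -/
def dimClass (a b β : ℝ) : Set C(Icc a b, ConvexCompacts) :=
  {f | dimH (svfGraph f) = ENNReal.ofReal β}

open MeasureTheory Measure Filter Topology
open scoped ENNReal NNReal

/-! A convex compact set is an interval `[v₁, v₁ + v₂]` with `v₂ ≥ 0`, and up to bi-Lipschitz change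
`f` is a continuous map `φ` into the plane (`dimH_svfGraph`). Metric sums of intervals are Minkowski
sums (`metricSum_Icc`), so it suffices to split `φ = γ + (φ - γ)` with nonnegative lengths and both
graphs of dimension `β`.

Pick a closed `E` over which the graph of `φ` has dimension exactly `β`
(`exists_isClosed_dimH_graph_eq`) and require `γ = φ / 2` on `E`: both summands then have dimension
`β` over `E`. Off `E`, a Baire category argument makes both graphs of dimension at most `β`
(`exists_mem_halvesOn_dimH_le`); the dense sets come from polynomial approximation and `β > 1`.

The set `E` comes from a Besicovitch-type subset theorem (`exists_isClosed_dimH_image_eq`), proved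
with dyadic contents on digit sequences. A closed set minimal among those of full content has the
same content at every scale, hence finite `β`-measure, while positive content bounds its dimension
from below. -/

/-! ### Covers, Hausdorff measure and dimension. -/

/-- The Hausdorff measure of a set vanishes if the set has countable covers with arbitrarily small
sums of powers of diameters. -/
theorem hausdorffMeasure_eq_zero_of_forall_cover {X : Type*} [EMetricSpace X] [MeasurableSpace X]
    [BorelSpace X] {s : ℝ} (hs : 0 < s) {S : Set X}
    (h : ∀ ε : ℝ≥0∞, 0 < ε →
      ∃ t : ℕ → Set X, S ⊆ ⋃ i, t i ∧ ∑' i, Metric.ediam (t i) ^ s ≤ ε) :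
    μH[s] S = 0 := by
  refine le_antisymm (ENNReal.le_of_forall_pos_le_add fun ε hε _ => ?_) bot_le
  rw [zero_add, hausdorffMeasure_apply]
  refine iSup₂_le fun r hr => ?_
  have hrs : 0 < r ^ s := ENNReal.rpow_pos_of_nonneg hr hs.le
  -- A total of at most `r ^ s` forces every single diameter below `r`, so no mesh condition on the
  -- covers is needed.
  obtain ⟨t, htS, ht⟩ := h (min ε (r ^ s)) (lt_min (by exact_mod_cast hε) hrs)
  refine iInf_le_of_le t (iInf_le_of_le htS (iInf_le_of_le (fun n => ?_) ?_))
  · have := (ENNReal.le_tsum n).trans (ht.trans (min_le_right _ _))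
    exact (ENNReal.rpow_le_rpow_iff hs).1 this
  · refine le_trans (ENNReal.tsum_le_tsum fun n => ?_) (ht.trans (min_le_left _ _))
    exact iSup_le fun _ => le_rfl

/-- A set of vanishing Hausdorff measure has covers by open balls with arbitrarily small sums of
powers of radii. -/
theorem exists_ball_cover_of_hausdorffMeasure_eq_zero {X : Type*} [MetricSpace X]
    [MeasurableSpace X] [BorelSpace X] [Nonempty X] {s : ℝ} (hs : 0 < s) {S : Set X}
    (h : μH[s] S = 0) {ε : ℝ≥0∞} (hε : 0 < ε) :
    ∃ (y : ℕ → X) (ρ : ℕ → ℝ≥0), (∀ i, 0 < ρ i) ∧ S ⊆ ⋃ i, Metric.ball (y i) (ρ i) ∧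
      ∑' i, (ρ i : ℝ≥0∞) ^ s < ε := by
  rw [hausdorffMeasure_apply] at h
  have h1 : (⨅ (t : ℕ → Set X) (_ : S ⊆ ⋃ n, t n) (_ : ∀ n, Metric.ediam (t n) ≤ 1),
          ∑' n, ⨆ _ : (t n).Nonempty, Metric.ediam (t n) ^ s) < ε / 2 := by
    refine lt_of_le_of_lt (le_of_le_of_eq ?_ h) (ENNReal.half_pos hε.ne')
    exact le_iSup₂_of_le (1 : ℝ≥0∞) one_pos le_rfl
  simp only [iInf_lt_iff] at h1
  obtain ⟨t, htS, htd, ht⟩ := h1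
  obtain ⟨δ, hδ0, hδ⟩ := ENNReal.exists_pos_sum_of_countable (ENNReal.half_pos hε.ne').ne' ℕ
  -- Radii strictly above the diameters let open balls cover and are positive even for one-point
  -- pieces; the slack `δ i` pays for this.
  have key : ∀ i, ∃ ρ : ℝ≥0, Metric.ediam (t i) < ρ ∧
      (ρ : ℝ≥0∞) ^ s ≤ Metric.ediam (t i) ^ s + δ i := by
    intro i
    have hfin : Metric.ediam (t i) ≠ ⊤ := ne_top_of_le_ne_top ENNReal.one_ne_top (htd i)
    have hlt : Metric.ediam (t i) ^ s < Metric.ediam (t i) ^ s + δ i :=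
      ENNReal.lt_add_right (ENNReal.rpow_ne_top_of_nonneg hs.le hfin)
        (by exact_mod_cast (hδ0 i).ne')
    have hlt2 : Metric.ediam (t i) < (Metric.ediam (t i) ^ s + δ i) ^ (1 / s) := by
      rw [← ENNReal.rpow_lt_rpow_iff hs, ← ENNReal.rpow_mul, one_div, inv_mul_cancel₀ hs.ne',
        ENNReal.rpow_one]
      exact hlt
    obtain ⟨ρ, h1, h2⟩ := ENNReal.lt_iff_exists_nnreal_btwn.1 hlt2
    refine ⟨ρ, h1, ?_⟩
    rw [← ENNReal.rpow_lt_rpow_iff hs, ← ENNReal.rpow_mul, one_div, inv_mul_cancel₀ hs.ne',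
        ENNReal.rpow_one] at h2
    exact h2.le
  choose ρ hρ1 hρ2 using key
  classical
  let x₀ : X := Classical.arbitrary X
  let y : ℕ → X := fun i => if hi : (t i).Nonempty then hi.some else x₀
  have hsub : S ⊆ ⋃ i, Metric.ball (y i) (ρ i) := by
    intro x hx
    obtain ⟨i, hi⟩ := mem_iUnion.1 (htS hx)
    have hne : (t i).Nonempty := ⟨x, hi⟩
    refine mem_iUnion.2 ⟨i, ?_⟩
    have : y i ∈ t i := by simp only [y, hne, dif_pos]; exact hne.some_mem
    rw [Metric.mem_ball, ← ENNReal.ofReal_lt_ofReal_iff_of_nonneg dist_nonneg, ← edist_dist]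
    simpa using (Metric.edist_le_ediam_of_mem hi this).trans_lt (hρ1 i)
  refine ⟨y, ρ, fun i => ENNReal.coe_pos.1 (bot_le.trans_lt (hρ1 i)), hsub, ?_⟩
  have hle : ∀ i, Metric.ediam (t i) ^ s ≤ ⨆ _ : (t i).Nonempty, Metric.ediam (t i) ^ s := by
    intro i
    rcases (t i).eq_empty_or_nonempty with h | h
    · simp [h, hs]
    · exact le_iSup_of_le h le_rfl
  calc ∑' i, (ρ i : ℝ≥0∞) ^ s
      ≤ ∑' i, ((⨆ _ : (t i).Nonempty, Metric.ediam (t i) ^ s) + δ i) :=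
        ENNReal.tsum_le_tsum fun i => (hρ2 i).trans (add_le_add_left (hle i) _)
    _ = _ := ENNReal.tsum_add
    _ < ε / 2 + ε / 2 := ENNReal.add_lt_add ht hδ
    _ = ε := ENNReal.add_halves ε

/-- If `F` contracts distances compared with `G` up to a constant, then images under `F` have at
most the Hausdorff dimension of images under `G`. -/
theorem dimH_image_le_of_edist_le {α X Y : Type*} [EMetricSpace X] [EMetricSpace Y]
    {F : α → X} {G : α → Y} (C : ℝ≥0) {S : Set α}
    (h : ∀ p ∈ S, ∀ q ∈ S, edist (F p) (F q) ≤ C * edist (G p) (G q)) :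
    dimH (F '' S) ≤ dimH (G '' S) := by
  rcases S.eq_empty_or_nonempty with rfl | ⟨x₀, hx₀⟩
  · simp
  have : Nonempty α := ⟨x₀⟩
  let J : Y → α := Function.invFunOn G S
  have hJ : ∀ y ∈ G '' S, J y ∈ S ∧ G (J y) = y := fun y hy =>
    ⟨Function.invFunOn_mem hy, Function.invFunOn_eq hy⟩
  have hL : LipschitzOnWith C (F ∘ J) (G '' S) := by
    intro y hy z hz
    have := h _ (hJ y hy).1 _ (hJ z hz).1
    rwa [(hJ y hy).2, (hJ z hz).2] at this
  refine le_trans (dimH_mono ?_) hL.dimH_image_le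
  rintro _ ⟨p, hp, rfl⟩
  refine ⟨G p, mem_image_of_mem _ hp, ?_⟩
  have h1 := hJ (G p) (mem_image_of_mem _ hp)
  have h2 := h _ h1.1 _ hp
  rw [h1.2, edist_self, mul_zero, nonpos_iff_eq_zero, edist_eq_zero] at h2
  exact h2

/-! ### Net measures on sequences and minimal closed sets. -/

/-- The cheapest price `r ^ n` of a cylinder of length `n ≥ k` containing `S`. -/
noncomputable def cylinderCost {A : Type*} (r : ℝ≥0∞) (k : ℕ) (S : Set (ℕ → A)) : ℝ≥0∞ :=
  ⨅ (n : ℕ) (_ : k ≤ n) (x : ℕ → A) (_ : S ⊆ PiNat.cylinder x n), r ^ n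

/-- The net outer measure on sequences: covers by cylinders of length at least `k`, where a cylinder
of length `n` has price `r ^ n`. -/
noncomputable def netMeasure (A : Type*) (r : ℝ≥0∞) (k : ℕ) : OuterMeasure (ℕ → A) :=
  OuterMeasure.boundedBy (cylinderCost r k)

section Net

variable {A : Type*} {r : ℝ≥0∞}

theorem netMeasure_cylinder_le (x : ℕ → A) {k n : ℕ} (h : k ≤ n) :
    netMeasure A r k (PiNat.cylinder x n) ≤ r ^ n :=
  (OuterMeasure.boundedBy_le _).trans
    (iInf_le_of_le n (iInf_le_of_le h (iInf_le_of_le x (iInf_le_of_le subset_rfl le_rfl))))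

theorem netMeasure_iUnion_cylinder_le {ι : Type*} [Countable ι] (x : ι → ℕ → A) {k : ℕ} {m : ι → ℕ}
    (h : ∀ i, k ≤ m i) {S : Set (ℕ → A)} (hS : S ⊆ ⋃ i, PiNat.cylinder (x i) (m i)) :
    netMeasure A r k S ≤ ∑' i, r ^ m i :=
  (measure_mono hS).trans ((measure_iUnion_le _).trans
    (ENNReal.tsum_le_tsum fun i => netMeasure_cylinder_le (x i) (h i)))

theorem exists_cylinder_cover_of_netMeasure_lt [Nonempty A] (hr : r < 1) {k : ℕ}
    {S : Set (ℕ → A)} {c : ℝ≥0∞} (h : netMeasure A r k S < c) :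
    ∃ (x : ℕ → ℕ → A) (m : ℕ → ℕ), (∀ i, k ≤ m i) ∧ S ⊆ ⋃ i, PiNat.cylinder (x i) (m i) ∧
      ∑' i, r ^ m i < c := by
  rw [netMeasure, OuterMeasure.boundedBy_apply] at h
  simp only [iInf_lt_iff] at h
  obtain ⟨t, htS, ht⟩ := h
  set w : ℕ → ℝ≥0∞ := fun i => ⨆ _ : (t i).Nonempty, cylinderCost r k (t i) with hw
  change ∑' i, w i < c at ht
  obtain ⟨δ, hδ0, hδ⟩ := ENNReal.exists_pos_sum_of_countable (tsub_pos_of_lt ht).ne' ℕ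
  have key : ∀ i, ∃ (x : ℕ → A) (m : ℕ), k ≤ m ∧ t i ⊆ PiNat.cylinder x m ∧ r ^ m ≤ w i + δ i := by
    intro i
    have hwi : w i ≠ ⊤ := ((ENNReal.le_tsum i).trans_lt ht).ne_top
    have hlt : w i < w i + δ i := ENNReal.lt_add_right hwi (by exact_mod_cast (hδ0 i).ne')
    -- Empty pieces are free in `boundedBy`, but a cylinder must still be supplied: a long one costs
    -- less than the slack `δ i`.
    rcases (t i).eq_empty_or_nonempty with h0 | h0
    · obtain ⟨n, hn⟩ := ((ENNReal.tendsto_pow_atTop_nhds_zero_of_lt_one hr).eventually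
        (gt_mem_nhds (show (0 : ℝ≥0∞) < δ i by exact_mod_cast hδ0 i))).exists_forall_of_atTop
      refine ⟨Classical.arbitrary _, max k n, le_max_left _ _, by simp [h0], ?_⟩
      exact (hn _ (le_max_right _ _)).le.trans le_add_self
    · have h1 : cylinderCost r k (t i) < w i + δ i := by
        refine lt_of_le_of_lt ?_ hlt
        exact le_iSup_of_le (f := fun _ : (t i).Nonempty => cylinderCost r k (t i)) h0 le_rfl
      simp only [cylinderCost, iInf_lt_iff] at h1
      obtain ⟨n, hn, x, hx, h1⟩ := h1
      exact ⟨x, n, hn, hx, h1.le⟩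
  choose x m hm hx hxm using key
  refine ⟨x, m, hm, htS.trans (iUnion_mono hx), ?_⟩
  calc ∑' i, r ^ m i ≤ ∑' i, (w i + δ i) := ENNReal.tsum_le_tsum hxm
    _ = ∑' i, w i + ∑' i, (δ i : ℝ≥0∞) := ENNReal.tsum_add
    _ < ∑' i, w i + (c - ∑' i, w i) := ENNReal.add_lt_add_left ht.ne_top hδ
    _ = c := add_tsub_cancel_of_le ht.le

/-- Cylinders are open, so near-optimal covers give outer regularity; this is what lets compactness
act on chains of closed sets. -/
theorem exists_isOpen_netMeasure_lt [Nonempty A] [TopologicalSpace A] [DiscreteTopology A]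
    (hr : r < 1) {k : ℕ} {S : Set (ℕ → A)} {c : ℝ≥0∞} (h : netMeasure A r k S < c) :
    ∃ U, IsOpen U ∧ S ⊆ U ∧ netMeasure A r k U < c := by
  obtain ⟨x, m, hm, hS, hc⟩ := exists_cylinder_cover_of_netMeasure_lt hr h
  exact ⟨_, isOpen_iUnion fun i => PiNat.isOpen_cylinder _ (x i) (m i), hS,
    (netMeasure_iUnion_cylinder_le x hm subset_rfl).trans_lt hc⟩

/-- Unless `S` costs as much as a cylinder of length `n`, only cylinders of greater length matter for
its net measure. -/
theorem min_pow_netMeasure_succ_le [Nonempty A] (hr : r < 1) (k n : ℕ) (S : Set (ℕ → A)) :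
    min (r ^ n) (netMeasure A r (n + 1) S) ≤ netMeasure A r k S := by
  by_contra! h
  obtain ⟨x, m, hm, hS, hc⟩ := exists_cylinder_cover_of_netMeasure_lt hr h
  have hlong : ∀ i, n + 1 ≤ m i := by
    intro i
    by_contra! hi
    have h1 : r ^ m i < r ^ n := (ENNReal.le_tsum i).trans_lt (hc.trans_le (min_le_left _ _))
    exact absurd h1 (not_lt.2 (pow_le_pow_right_of_le_one' hr.le (by omega)))
  exact absurd (hc.trans_le (min_le_right _ _))
    (not_lt.2 (netMeasure_iUnion_cylinder_le x hlong hS))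

theorem cylinder_subset_cylinder {x y z : ℕ → A} {m n : ℕ} (hmn : m ≤ n)
    (hx : z ∈ PiNat.cylinder x m) (hy : z ∈ PiNat.cylinder y n) :
    PiNat.cylinder y n ⊆ PiNat.cylinder x m := by
  rw [← PiNat.mem_cylinder_iff_eq.1 hx, ← PiNat.mem_cylinder_iff_eq.1 hy]
  exact PiNat.cylinder_anti z hmn

/-- If the trace of `S` on a cylinder is as expensive as the cylinder, then adding the whole
cylinder to `S` does not increase the net measure. -/
theorem netMeasure_union_cylinder_le [Nonempty A] (hr : r < 1) (S : Set (ℕ → A)) (x : ℕ → A)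
    (n : ℕ) (h : r ^ n ≤ netMeasure A r 0 (S ∩ PiNat.cylinder x n)) :
    netMeasure A r 0 (S ∪ PiNat.cylinder x n) ≤ netMeasure A r 0 S := by
  refine le_of_forall_gt fun c hc => ?_
  obtain ⟨y, m, -, hS, hc⟩ := exists_cylinder_cover_of_netMeasure_lt hr hc
  refine lt_of_le_of_lt ?_ hc
  by_cases hQ : ∃ i, PiNat.cylinder x n ⊆ PiNat.cylinder (y i) (m i)
  · obtain ⟨i, hi⟩ := hQ
    exact netMeasure_iUnion_cylinder_le y (fun i => Nat.zero_le _)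
      (union_subset hS (hi.trans (subset_iUnion (fun i => PiNat.cylinder (y i) (m i)) i)))
  push Not at hQ
  -- Cylinders are nested or disjoint, so those meeting `PiNat.cylinder x n` now lie inside it.
  -- Together they cost at least `r ^ n` and can be exchanged for the whole cylinder.
  set J : Set ℕ := {i | PiNat.cylinder (y i) (m i) ⊆ PiNat.cylinder x n} with hJ
  have hdis : ∀ i, ∀ z ∈ PiNat.cylinder (y i) (m i), z ∈ PiNat.cylinder x n → i ∈ J := by
    intro i z hz hzx
    rcases le_total n (m i) with hle | hle
    · exact cylinder_subset_cylinder hle hzx hz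
    · exact absurd (cylinder_subset_cylinder hle hz hzx) (hQ i)
  have h1 : r ^ n ≤ ∑' i : J, r ^ m i := by
    refine h.trans (netMeasure_iUnion_cylinder_le (fun i : J => y i) (fun i => Nat.zero_le _) ?_)
    rintro z ⟨hzS, hzx⟩
    obtain ⟨i, hi⟩ := mem_iUnion.1 (hS hzS)
    exact mem_iUnion.2 ⟨⟨i, hdis i z hi hzx⟩, hi⟩
  have hcov : S ∪ PiNat.cylinder x n ⊆
      PiNat.cylinder x n ∪ ⋃ i : (Jᶜ : Set ℕ), PiNat.cylinder (y i) (m i) := by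
    rintro z (hz | hz)
    · obtain ⟨i, hi⟩ := mem_iUnion.1 (hS hz)
      by_cases hiJ : i ∈ J
      · exact Or.inl (hiJ hi)
      · exact Or.inr (mem_iUnion.2 ⟨⟨i, hiJ⟩, hi⟩)
    · exact Or.inl hz
  calc netMeasure A r 0 (S ∪ PiNat.cylinder x n)
      ≤ netMeasure A r 0 (PiNat.cylinder x n) +
          netMeasure A r 0 (⋃ i : (Jᶜ : Set ℕ), PiNat.cylinder (y i) (m i)) :=
        (measure_mono hcov).trans (measure_union_le _ _)
    _ ≤ r ^ n + ∑' i : (Jᶜ : Set ℕ), r ^ m i := by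
        gcongr
        · exact netMeasure_cylinder_le x (Nat.zero_le _)
        · exact netMeasure_iUnion_cylinder_le (fun i : (Jᶜ : Set ℕ) => y i)
            (fun i => Nat.zero_le _) subset_rfl
    _ ≤ ∑' i : J, r ^ m i + ∑' i : (Jᶜ : Set ℕ), r ^ m i := by gcongr
    _ = ∑' i, r ^ m i :=
        ENNReal.summable.tsum_add_tsum_compl (f := fun i => r ^ m i) ENNReal.summable

variable [TopologicalSpace A] [DiscreteTopology A] [Finite A] [Nonempty A]

/-- Minimal closed sets of given net measure exist. -/
theorem exists_minimal_netMeasure (hr : r < 1) {K : Set (ℕ → A)} (hK : IsClosed K) :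
    ∃ E, Minimal (· ∈ {E : Set (ℕ → A) | IsClosed E ∧ E ⊆ K ∧
      netMeasure A r 0 K ≤ netMeasure A r 0 E}) E := by
  refine (zorn_superset_nonempty {E : Set (ℕ → A) | IsClosed E ∧ E ⊆ K ∧
      netMeasure A r 0 K ≤ netMeasure A r 0 E} (fun C hC hchain hne => ?_) K
    ⟨hK, subset_rfl, le_rfl⟩).imp fun E hE => hE.2
  have : Nonempty C := hne.to_subtype
  refine ⟨⋂₀ C, ⟨isClosed_sInter fun E hE => (hC hE).1, ?_, ?_⟩, fun s hs => sInter_subset_of_mem hs⟩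
  · obtain ⟨E, hE⟩ := hne
    exact (sInter_subset_of_mem hE).trans (hC hE).2.1
  · by_contra! h
    -- If the intersection were too cheap, so would be an open neighbourhood of it, and by
    -- compactness a member of the chain lies in that neighbourhood.
    obtain ⟨U, hU, hCU, hlt⟩ := exists_isOpen_netMeasure_lt hr h
    rw [sInter_eq_iInter] at hCU
    obtain ⟨E, hE⟩ := exists_subset_nhds_of_isCompact (V := fun E : C => (E : Set (ℕ → A)))
      (fun E E' => (hchain.total E.2 E'.2).elim (fun h => ⟨E, subset_rfl, h⟩)
        fun h => ⟨E', h, subset_rfl⟩)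
      (fun E => (hC E.2).1.isCompact) (U := U)
      (fun x hx => hU.mem_nhds (hCU hx))
    exact absurd (((hC E.2).2.2.trans (measure_mono hE)).trans_lt hlt) (lt_irrefl _)

/-- A closed set of sequences contains a closed subset of the same net measure on which the net
measure can be computed by arbitrarily long cylinders. -/
theorem exists_isClosed_netMeasure_le (hr : r < 1) {K : Set (ℕ → A)}
    (hK : IsClosed K) :
    ∃ E ⊆ K, IsClosed E ∧ netMeasure A r 0 K ≤ netMeasure A r 0 E ∧
      ∀ n, netMeasure A r n E ≤ netMeasure A r 0 E := by
  obtain ⟨E, ⟨hEc, hEK, hEm⟩, hmin⟩ := exists_minimal_netMeasure hr hK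
  -- If a trace were dearer than its cylinder, a small enough piece of `E` could be deleted there
  -- with the trace still costing `r ^ n`. Filling in the cylinder is then free, so the smaller set
  -- keeps full content, against minimality.
  have local_bound : ∀ x n, netMeasure A r (n + 1) (E ∩ PiNat.cylinder x n) ≤ r ^ n := by
    intro x n
    by_contra! h
    obtain ⟨y, hyE, hyx⟩ : (E ∩ PiNat.cylinder x n).Nonempty := by
      rw [nonempty_iff_ne_empty]
      intro h0
      simp [h0] at h
    obtain ⟨m, hm⟩ := ((ENNReal.tendsto_pow_atTop_nhds_zero_of_lt_one hr).eventually
        (gt_mem_nhds (tsub_pos_of_lt h))).exists_forall_of_atTop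
    -- The bound `m` makes the deleted cylinder cheaper than the excess; `n + 1` makes it admissible
    -- at this level and places it inside `PiNat.cylinder x n`.
    set p := max m (n + 1)
    set E' := E \ PiNat.cylinder y p with hE'
    have h1 : r ^ n ≤ netMeasure A r (n + 1) (E' ∩ PiNat.cylinder x n) := by
      have h2 : netMeasure A r (n + 1) (E ∩ PiNat.cylinder x n) ≤
          netMeasure A r (n + 1) (E' ∩ PiNat.cylinder x n) + r ^ p := by
        refine le_trans (measure_mono ?_) ((measure_union_le _ _).trans
          (add_le_add_right (netMeasure_cylinder_le y (le_max_right m (n + 1))) _))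
        rintro z ⟨hzE, hzx⟩
        by_cases hz : z ∈ PiNat.cylinder y p
        · exact Or.inr hz
        · exact Or.inl ⟨⟨hzE, hz⟩, hzx⟩
      by_contra! h3
      have h4 := hm p (le_max_left _ _)
      have h5 := ENNReal.add_lt_add h3 h4
      rw [add_tsub_cancel_of_le h.le] at h5
      exact absurd (h2.trans_lt h5) (lt_irrefl _)
    have h2 : r ^ n ≤ netMeasure A r 0 (E' ∩ PiNat.cylinder x n) :=
      le_trans (le_min le_rfl h1) (min_pow_netMeasure_succ_le hr 0 n _)
    have h3 : E ⊆ E' ∪ PiNat.cylinder x n := by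
      intro z hz
      by_cases hzy : z ∈ PiNat.cylinder y p
      · exact Or.inr (cylinder_subset_cylinder (Nat.le_of_succ_le (le_max_right m (n + 1))) hyx
          (PiNat.self_mem_cylinder y p) hzy)
      · exact Or.inl ⟨hz, hzy⟩
    have h4 : netMeasure A r 0 K ≤ netMeasure A r 0 E' :=
      hEm.trans ((measure_mono h3).trans (netMeasure_union_cylinder_le hr E' x n h2))
    have h5 : E ⊆ E' := hmin ⟨hEc.sdiff (PiNat.isOpen_cylinder _ y p), sdiff_subset.trans hEK, h4⟩
      sdiff_subset
    exact (h5 hyE).2 (PiNat.self_mem_cylinder y p)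
  refine ⟨E, hEK, hEc, hEm, fun n => ?_⟩
  induction n with
  | zero => exact le_rfl
  | succ n ih =>
    -- In a cover by cylinders of length at least `n`, only those of length exactly `n` are
    -- inadmissible at level `n + 1`; `local_bound` replaces their traces at no extra cost.
    refine le_trans (le_of_forall_gt fun c hc => ?_) ih
    obtain ⟨x, m, hm, hS, hc⟩ := exists_cylinder_cover_of_netMeasure_lt hr hc
    refine lt_of_le_of_lt ?_ hc
    calc netMeasure A r (n + 1) E
        ≤ netMeasure A r (n + 1) (⋃ i, E ∩ PiNat.cylinder (x i) (m i)) := by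
          rw [← inter_iUnion]; exact measure_mono (subset_inter subset_rfl hS)
      _ ≤ ∑' i, netMeasure A r (n + 1) (E ∩ PiNat.cylinder (x i) (m i)) := measure_iUnion_le _
      _ ≤ ∑' i, r ^ m i := by
          refine ENNReal.tsum_le_tsum fun i => ?_
          rcases (hm i).eq_or_lt with h | h
          · rw [← h]; exact local_bound _ _
          · exact (measure_mono inter_subset_right).trans (netMeasure_cylinder_le _ h)

end Net

/-! ### Binary coding of the unit cube and the subset theorem. -/

/-- The integer with binary digits `d 0, …, d (k - 1)`, the leading digit first. -/
def binaryPrefix (d : ℕ → Fin 2) : ℕ → ℕ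
  | 0 => 0
  | k + 1 => 2 * binaryPrefix d k + d k

theorem eq_of_binaryPrefix_eq {d e : ℕ → Fin 2} {k : ℕ} (h : binaryPrefix d k = binaryPrefix e k) :
    ∀ i < k, d i = e i := by
  induction k with
  | zero => simp
  | succ k ih =>
    simp only [binaryPrefix] at h
    have h1 := (d k).isLt
    have h2 := (e k).isLt
    intro i hi
    rcases Nat.lt_succ_iff_lt_or_eq.1 hi with hi | rfl
    · exact ih (by omega) i hi
    · exact Fin.ext (by omega)

theorem two_pow_mul_sum_ofDigitsTerm (d : ℕ → Fin 2) (k : ℕ) :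
    2 ^ k * ∑ i ∈ Finset.range k, Real.ofDigitsTerm d i = binaryPrefix d k := by
  induction k with
  | zero => simp [binaryPrefix]
  | succ k ih =>
    rw [Finset.sum_range_succ, mul_add, pow_succ', mul_assoc, ih, ← pow_succ', Real.ofDigitsTerm,
      binaryPrefix]
    push_cast
    field_simp

theorem binaryPrefix_le (d : ℕ → Fin 2) (k : ℕ) :
    (binaryPrefix d k : ℝ) ≤ 2 ^ k * Real.ofDigits d ∧
      2 ^ k * Real.ofDigits d ≤ binaryPrefix d k + 1 := by
  rw [Real.ofDigits_eq_sum_add_ofDigits d k, mul_add, two_pow_mul_sum_ofDigitsTerm, Nat.cast_ofNat,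
    mul_inv_cancel_left₀ (by positivity)]
  exact ⟨by linarith [Real.ofDigits_nonneg fun i => d (i + k)],
    by linarith [Real.ofDigits_le_one fun i => d (i + k)]⟩

section Coding

variable {ι : Type*}

/-- The point of the unit cube whose coordinates have the given binary digits. -/
noncomputable def cubeCode (σ : ℕ → ι → Fin 2) : ι → ℝ :=
  fun j => Real.ofDigits fun i => σ i j

theorem continuous_cubeCode : Continuous (cubeCode : (ℕ → ι → Fin 2) → ι → ℝ) :=
  continuous_pi fun j => Real.continuous_ofDigits.comp
    (continuous_pi fun i => (continuous_apply j).comp (continuous_apply i))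

theorem exists_cubeCode_eq {p : ι → ℝ} (hp : ∀ j, p j ∈ Icc (0 : ℝ) 1) :
    ∃ σ, cubeCode σ = p := by
  choose d _ hd using fun j => Real.ofDigits_SurjOn (b := 2) one_lt_two (hp j)
  exact ⟨fun i j => d j i, funext hd⟩

variable [Fintype ι]

theorem ediam_cubeCode_image_cylinder_le (x : ℕ → ι → Fin 2) (n : ℕ) :
    Metric.ediam (cubeCode '' PiNat.cylinder x n) ≤ (2⁻¹ : ℝ≥0∞) ^ n := by
  refine Metric.ediam_le ?_
  rintro _ ⟨σ, hσ, rfl⟩ _ ⟨τ, hτ, rfl⟩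
  refine edist_pi_le_iff.2 fun j => ?_
  have := Real.abs_ofDigits_sub_ofDigits_le (b := 2) (x := fun i => σ i j) (y := fun i => τ i j)
    (n := n) (fun i hi => by rw [hσ i hi, hτ i hi])
  rw [edist_dist, Real.dist_eq, ← ENNReal.inv_pow]
  refine (ENNReal.ofReal_le_ofReal this).trans_eq ?_
  rw [ENNReal.ofReal_inv_of_pos (by positivity), ENNReal.ofReal_pow (by positivity)]
  simp

/-- A ball of radius at most `2⁻ᵏ` meets at most `3` to the dimension many cubes of generation `k`. -/
theorem netMeasure_preimage_ball_le_of_le {r : ℝ≥0∞} {k : ℕ} (y : ι → ℝ) {ρ : ℝ}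
    (hρ : ρ ≤ (2⁻¹ : ℝ) ^ k) :
    netMeasure (ι → Fin 2) r 0 (cubeCode ⁻¹' Metric.ball y ρ) ≤ 3 ^ Fintype.card ι * r ^ k := by
  classical
  -- If the point has coordinate `t` and prefix `N`, then `N ≤ 2 ^ k * t ≤ N + 1` and `2 ^ k * t` is
  -- within 1 of `2 ^ k * y j`, leaving three integers for `N`.
  let Z : Finset (ι → ℤ) := Fintype.piFinset fun j => Finset.Icc (⌈2 ^ k * y j⌉ - 2) ⌈2 ^ k * y j⌉
  let T : (ι → ℤ) → Set (ℕ → ι → Fin 2) := fun z =>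
    {σ | ∀ j, (binaryPrefix (fun i => σ i j) k : ℤ) = z j}
  have hcov : cubeCode ⁻¹' Metric.ball y ρ ⊆ ⋃ z ∈ Z, T z := by
    intro σ hσ
    refine mem_iUnion₂.2 ⟨fun j => (binaryPrefix (fun i => σ i j) k : ℤ), ?_, fun j => rfl⟩
    refine Fintype.mem_piFinset.2 fun j => Finset.mem_Icc.2 ?_
    have h1 : |cubeCode σ j - y j| < (2⁻¹ : ℝ) ^ k :=
      (dist_le_pi_dist (cubeCode σ) y j).trans_lt ((Metric.mem_ball.1 hσ).trans_le hρ)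
    have h2 := binaryPrefix_le (fun i => σ i j) k
    have h3 : |2 ^ k * cubeCode σ j - 2 ^ k * y j| < 1 := by
      rw [← mul_sub, abs_mul, abs_of_pos (by positivity : (0 : ℝ) < 2 ^ k)]
      calc (2 : ℝ) ^ k * |cubeCode σ j - y j| < 2 ^ k * (2⁻¹ : ℝ) ^ k := by gcongr
        _ = 1 := by rw [← mul_pow]; norm_num
    rw [abs_lt] at h3
    change _ ≤ 2 ^ k * cubeCode σ j ∧ 2 ^ k * cubeCode σ j ≤ _ at h2
    have h4 := Int.ceil_lt_add_one (2 ^ k * y j)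
    have h5 := Int.le_ceil (2 ^ k * y j)
    constructor
    · have : (⌈2 ^ k * y j⌉ : ℝ) - 3 < (binaryPrefix (fun i => σ i j) k : ℝ) := by linarith
      have : ⌈2 ^ k * y j⌉ - 3 < (binaryPrefix (fun i => σ i j) k : ℤ) := by exact_mod_cast this
      omega
    · have : (binaryPrefix (fun i => σ i j) k : ℝ) < (⌈2 ^ k * y j⌉ : ℝ) + 1 := by linarith
      have : (binaryPrefix (fun i => σ i j) k : ℤ) < ⌈2 ^ k * y j⌉ + 1 := by exact_mod_cast this
      omega
  have hT : ∀ z, netMeasure (ι → Fin 2) r 0 (T z) ≤ r ^ k := by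
    intro z
    rcases (T z).eq_empty_or_nonempty with h0 | ⟨τ, hτ⟩
    · simp [h0]
    · refine (measure_mono ?_).trans (netMeasure_cylinder_le τ (Nat.zero_le k))
      intro σ hσ i hi
      funext j
      exact eq_of_binaryPrefix_eq (by exact_mod_cast (hσ j).trans (hτ j).symm) i hi
  calc netMeasure (ι → Fin 2) r 0 (cubeCode ⁻¹' Metric.ball y ρ)
      ≤ ∑ z ∈ Z, netMeasure (ι → Fin 2) r 0 (T z) :=
        (measure_mono hcov).trans (measure_biUnion_finset_le _ _)
    _ ≤ Z.card • r ^ k := Finset.sum_le_card_nsmul _ _ _ fun z _ => hT z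
    _ = 3 ^ Fintype.card ι * r ^ k := by
        have : Z.card = 3 ^ Fintype.card ι := by
          rw [Fintype.card_piFinset]
          simp only [Int.card_Icc]
          rw [Finset.prod_congr rfl (g := fun _ => 3) (fun j _ => by omega)]
          simp
        rw [this, nsmul_eq_mul]
        push_cast
        rfl

theorem rpow_inv_two_pow (β : ℝ) (m : ℕ) :
    ((2⁻¹ : ℝ≥0∞) ^ β) ^ m = ((2⁻¹ : ℝ≥0∞) ^ m) ^ β := by
  rw [← ENNReal.rpow_natCast, ← ENNReal.rpow_natCast, ← ENNReal.rpow_mul, ← ENNReal.rpow_mul,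
    mul_comm]

/-- Rounding the radius up to a power of `1/2` costs the factor `r⁻¹`; for radii at least 1 the
whole space, of price 1, suffices. Ball covers thus bound the content, which yields the lower
dimension bound. -/
theorem netMeasure_preimage_ball_le {β : ℝ} (hβ : 0 < β) (y : ι → ℝ) {ρ : ℝ≥0} (hρ : 0 < ρ) :
    netMeasure (ι → Fin 2) ((2⁻¹ : ℝ≥0∞) ^ β) 0 (cubeCode ⁻¹' Metric.ball y ρ) ≤
      3 ^ Fintype.card ι * ((2⁻¹ : ℝ≥0∞) ^ β)⁻¹ * (ρ : ℝ≥0∞) ^ β := by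
  set r : ℝ≥0∞ := (2⁻¹ : ℝ≥0∞) ^ β with hr
  have hr1 : r ≤ 1 := ENNReal.rpow_le_one (by simp) hβ.le
  have hr0 : r ≠ 0 := (ENNReal.rpow_pos (by simp) (by simp)).ne'
  rcases le_or_gt 1 ρ with h1 | h1
  · have h2 : netMeasure (ι → Fin 2) r 0 (cubeCode ⁻¹' Metric.ball y ρ) ≤ 1 := by
      refine (measure_mono (subset_univ _)).trans ?_
      simpa using netMeasure_cylinder_le (r := r) (fun _ _ => 0 : ℕ → ι → Fin 2) (Nat.zero_le 0)
    refine h2.trans ?_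
    have h3 : (1 : ℝ≥0∞) ≤ (ρ : ℝ≥0∞) ^ β := ENNReal.one_le_rpow (by exact_mod_cast h1) hβ
    have h4 : (1 : ℝ≥0∞) ≤ r⁻¹ := ENNReal.one_le_inv.2 hr1
    have h5 : (1 : ℝ≥0∞) ≤ 3 ^ Fintype.card ι := one_le_pow₀ (by norm_num)
    exact one_le_mul (one_le_mul h5 h4) h3
  · obtain ⟨k, hk1, hk2⟩ := exists_nat_pow_near_of_lt_one (x := (ρ : ℝ)) (y := 2⁻¹)
      (by exact_mod_cast hρ) (by exact_mod_cast h1.le) (by norm_num) (by norm_num)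
    refine (netMeasure_preimage_ball_le_of_le y hk2).trans ?_
    rw [mul_assoc]
    gcongr
    have h2 : r ^ (k + 1) ≤ (ρ : ℝ≥0∞) ^ β := by
      rw [hr, rpow_inv_two_pow]
      refine ENNReal.rpow_le_rpow ?_ hβ.le
      have : (2⁻¹ : ℝ≥0) ^ (k + 1) ≤ ρ := by
        rw [← NNReal.coe_le_coe]; push_cast; exact hk1.le
      have h3 : (((2⁻¹ : ℝ≥0) ^ (k + 1) : ℝ≥0) : ℝ≥0∞) ≤ ρ := by exact_mod_cast this
      simpa [ENNReal.inv_pow] using h3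
    calc r ^ k = r⁻¹ * r ^ (k + 1) := by
          rw [pow_succ', ← mul_assoc, ENNReal.inv_mul_cancel hr0 (ne_top_of_le_ne_top (by simp) hr1),
            one_mul]
      _ ≤ r⁻¹ * (ρ : ℝ≥0∞) ^ β := by gcongr

/-- A continuous image in the unit cube of dimension greater than `β` contains the image of a closed
set of dimension exactly `β`. -/
theorem exists_isClosed_dimH_image_eq {X : Type*} [TopologicalSpace X] [CompactSpace X]
    {F : X → ι → ℝ} (hF : Continuous F) (hF01 : ∀ x j, F x j ∈ Icc (0 : ℝ) 1) {β : ℝ≥0}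
    (hβ : 0 < β) (h : β < dimH (range F)) :
    ∃ E : Set X, IsClosed E ∧ dimH (F '' E) = β := by
  set r : ℝ≥0∞ := (2⁻¹ : ℝ≥0∞) ^ (β : ℝ) with hr
  have hβ' : (0 : ℝ) < β := by exact_mod_cast hβ
  have hr1 : r < 1 := ENNReal.rpow_lt_one (by simp) hβ'
  have hr0 : r ≠ 0 := (ENNReal.rpow_pos (by simp) (by simp)).ne'
  have hcode : ∀ (x : ℕ → ι → Fin 2) (m : ℕ),
      Metric.ediam (cubeCode '' PiNat.cylinder x m) ^ (β : ℝ) ≤ r ^ m := by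
    intro x m
    rw [hr, rpow_inv_two_pow]
    exact ENNReal.rpow_le_rpow (ediam_cubeCode_image_cylinder_le x m) hβ'.le
  set K : Set (ℕ → ι → Fin 2) := cubeCode ⁻¹' range F
  have hK : IsClosed K := (isCompact_range hF).isClosed.preimage continuous_cubeCode
  have hKF : range F ⊆ cubeCode '' K := by
    rintro _ ⟨x, rfl⟩
    obtain ⟨σ, hσ⟩ := exists_cubeCode_eq (hF01 x)
    exact ⟨σ, ⟨x, hσ.symm⟩, hσ⟩
  have hK0 : netMeasure (ι → Fin 2) r 0 K ≠ 0 := by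
    intro h0
    have h1 : μH[(β : ℝ)] (range F) = 0 := by
      refine hausdorffMeasure_eq_zero_of_forall_cover hβ' fun ε hε => ?_
      rw [← h0] at hε
      obtain ⟨x, m, -, hS, hlt⟩ := exists_cylinder_cover_of_netMeasure_lt hr1 hε
      refine ⟨fun i => cubeCode '' PiNat.cylinder (x i) (m i), ?_, ?_⟩
      · rw [← image_iUnion]
        exact hKF.trans (image_mono hS)
      · exact (ENNReal.tsum_le_tsum fun i => hcode _ _).trans hlt.le
    rw [hausdorffMeasure_of_lt_dimH h] at h1
    exact ENNReal.top_ne_zero h1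
  obtain ⟨E, hEK, hEc, hE0, hE⟩ := exists_isClosed_netMeasure_le hr1 hK
  have hTc : IsClosed (cubeCode '' E) := (hEc.isCompact.image continuous_cubeCode).isClosed
  have hTF : cubeCode '' E ⊆ range F := image_subset_iff.2 hEK
  refine ⟨F ⁻¹' (cubeCode '' E), hTc.preimage hF, ?_⟩
  rw [image_preimage_eq_of_subset hTF]
  apply le_antisymm
  · apply dimH_le_of_hausdorffMeasure_ne_top
    -- The content at level 0 is at most 1 and bounds all levels, so there are covers of mesh `2⁻ⁿ`
    -- with uniformly bounded sums.
    have h2 : ∀ n, netMeasure (ι → Fin 2) r n E < 2 := by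
      intro n
      refine (hE n).trans_lt (lt_of_le_of_lt ?_ ENNReal.one_lt_two)
      refine (measure_mono (subset_univ _)).trans ?_
      simpa using netMeasure_cylinder_le (r := r) (fun _ _ => 0 : ℕ → ι → Fin 2) (Nat.zero_le 0)
    choose x m hm hS hlt using fun n => exists_cylinder_cover_of_netMeasure_lt hr1 (h2 n)
    refine ne_top_of_le_ne_top ENNReal.ofNat_ne_top (b := 2) ?_
    refine (hausdorffMeasure_le_liminf_tsum (l := atTop) (β : ℝ) (cubeCode '' E)
      (fun n : ℕ => (2⁻¹ : ℝ≥0∞) ^ n) (ENNReal.tendsto_pow_atTop_nhds_zero_of_lt_one (by simp))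
      (fun n i => cubeCode '' PiNat.cylinder (x n i) (m n i)) ?_ ?_).trans ?_
    · refine Eventually.of_forall fun n i => (ediam_cubeCode_image_cylinder_le _ _).trans ?_
      exact pow_le_pow_right_of_le_one' (by simp) (hm n i)
    · refine Eventually.of_forall fun n => ?_
      rw [← image_iUnion]
      exact image_mono (hS n)
    · refine liminf_le_of_le (by isBoundedDefault) fun b hb => ?_
      obtain ⟨n, hn⟩ := hb.exists
      exact hn.trans ((ENNReal.tsum_le_tsum fun i => hcode _ _).trans (hlt n).le)
  · by_contra! hlt
    set C : ℝ≥0∞ := 3 ^ Fintype.card ι * r⁻¹ with hC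
    have hC0 : C ≠ 0 := mul_ne_zero (pow_ne_zero _ (by norm_num))
      (ENNReal.inv_ne_zero.2 hr1.ne_top)
    have hCt : C ≠ ⊤ := ENNReal.mul_ne_top (ENNReal.pow_ne_top (by norm_num))
      (ENNReal.inv_ne_top.2 hr0)
    have hpos : 0 < netMeasure (ι → Fin 2) r 0 E / C :=
      ENNReal.div_pos (hE0.trans_lt' hK0.bot_lt).ne' hCt
    obtain ⟨y, ρ, hρ, hcov, hsum⟩ := exists_ball_cover_of_hausdorffMeasure_eq_zero hβ'
      (hausdorffMeasure_of_dimH_lt hlt) hpos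
    have h3 : netMeasure (ι → Fin 2) r 0 E ≤ C * ∑' i, (ρ i : ℝ≥0∞) ^ (β : ℝ) := by
      have h4 : E ⊆ ⋃ i, cubeCode ⁻¹' Metric.ball (y i) (ρ i) := by
        rw [← preimage_iUnion]
        exact image_subset_iff.1 hcov
      refine (measure_mono h4).trans ((measure_iUnion_le _).trans ?_)
      rw [← ENNReal.tsum_mul_left]
      exact ENNReal.tsum_le_tsum fun i => netMeasure_preimage_ball_le hβ' (y i) (hρ i)
    have h5 := ENNReal.mul_lt_mul_right hC0 hCt hsum
    rw [ENNReal.mul_div_cancel hC0 hCt] at h5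
    exact absurd (h3.trans_lt h5) (lt_irrefl _)

end Coding

/-! ### Small graph covers as open conditions. -/

section Graph

variable {X V : Type*} [MetricSpace X] [MetricSpace V]

/-- The continuous functions whose graph over `K` has a cover by balls of small total size. -/
def smallGraphCover (K : Set X) (s : ℝ) (ε : ℝ≥0∞) : Set C(X, V) :=
  {g | ∃ (y : ℕ → X × V) (ρ : ℕ → ℝ≥0), (fun x => (x, g x)) '' K ⊆ ⋃ i, Metric.ball (y i) (ρ i) ∧
    ∑' i, (ρ i : ℝ≥0∞) ^ s < ε}

/-- The graph over `K` is compact, so the union of covering balls contains a thickening of it; the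
same balls serve all uniformly close functions. -/
theorem isOpen_smallGraphCover [CompactSpace X] {K : Set X} (hK : IsClosed K) (s : ℝ) (ε : ℝ≥0∞) :
    IsOpen (smallGraphCover K s ε : Set C(X, V)) := by
  refine Metric.isOpen_iff.2 fun g ⟨y, ρ, hcov, hsum⟩ => ?_
  have hc : IsCompact ((fun x => (x, g x)) '' K) :=
    hK.isCompact.image (continuous_id.prodMk g.continuous)
  obtain ⟨δ, hδ, hthick⟩ := hc.exists_thickening_subset_open
    (isOpen_iUnion fun i => Metric.isOpen_ball) hcov
  refine ⟨δ, hδ, fun g' hg' => ⟨y, ρ, ?_, hsum⟩⟩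
  rintro _ ⟨x, hx, rfl⟩
  refine hthick (Metric.mem_thickening_iff.2 ⟨_, mem_image_of_mem _ hx, ?_⟩)
  rw [Prod.dist_eq, dist_self]
  exact max_lt hδ ((ContinuousMap.dist_apply_le_dist x).trans_lt hg')

variable [MeasurableSpace (X × V)] [BorelSpace (X × V)]

theorem mem_smallGraphCover {K : Set X} {s : ℝ} (hs : 0 < s) {ε : ℝ≥0∞} (hε : 0 < ε)
    [Nonempty (X × V)] {g : C(X, V)} (h : μH[s] ((fun x => (x, g x)) '' K) = 0) :
    g ∈ smallGraphCover K s ε := by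
  obtain ⟨y, ρ, -, h1, h2⟩ := exists_ball_cover_of_hausdorffMeasure_eq_zero hs h hε
  exact ⟨y, ρ, h1, h2⟩

/-- Countably many thresholds suffice, so with openness the vanishing of the measure becomes a `G_δ`
condition fit for Baire. -/
theorem hausdorffMeasure_graph_eq_zero {K : Set X} {s : ℝ} (hs : 0 < s) {g : C(X, V)}
    (h : ∀ m : ℕ, g ∈ smallGraphCover K s ((m : ℝ≥0∞) + 1)⁻¹) :
    μH[s] ((fun x => (x, g x)) '' K) = 0 := by
  refine hausdorffMeasure_eq_zero_of_forall_cover hs fun ε hε => ?_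
  have h2 : (2 : ℝ≥0∞) ^ s ≠ ⊤ := ENNReal.rpow_ne_top_of_nonneg hs.le (by simp)
  obtain ⟨m, hm⟩ := ENNReal.exists_inv_nat_lt (ENNReal.div_pos hε.ne' h2).ne'
  obtain ⟨y, ρ, hcov, hsum⟩ := h m
  refine ⟨_, hcov, ?_⟩
  calc ∑' i, Metric.ediam (Metric.ball (y i) (ρ i)) ^ s
      ≤ ∑' i, (2 : ℝ≥0∞) ^ s * (ρ i : ℝ≥0∞) ^ s := by
        refine ENNReal.tsum_le_tsum fun i => ?_
        rw [← ENNReal.mul_rpow_of_nonneg _ _ hs.le]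
        refine ENNReal.rpow_le_rpow ?_ hs.le
        rw [← Metric.eball_coe]
        exact Metric.ediam_eball_le
    _ = 2 ^ s * ∑' i, (ρ i : ℝ≥0∞) ^ s := ENNReal.tsum_mul_left
    _ ≤ 2 ^ s * (ε / 2 ^ s) := by
        gcongr
        refine hsum.le.trans (le_trans ?_ hm.le)
        exact ENNReal.inv_le_inv.2 le_self_add
    _ ≤ ε := ENNReal.mul_div_le

end Graph

/-! ### Baire category: splitting `f` with small graphs off `E`. -/

section Decomposition

variable {a b : ℝ}

/-- The summands `g` of `f` with both second coordinates nonnegative which agree with `f / 2` on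
`E`. -/
def halvesOn (f : C(Icc a b, ℝ × ℝ)) (E : Set (Icc a b)) : Set C(Icc a b, ℝ × ℝ) :=
  {g | (∀ x ∈ E, g x = (2⁻¹ : ℝ) • f x) ∧ ∀ x, 0 ≤ (g x).2 ∧ (g x).2 ≤ (f x).2}

theorem isClosed_halvesOn (f : C(Icc a b, ℝ × ℝ)) (E : Set (Icc a b)) :
    IsClosed (halvesOn f E) := by
  have hev : ∀ x, Continuous fun g : C(Icc a b, ℝ × ℝ) => g x := fun x =>
    ContinuousEvalConst.continuous_eval_const x
  simp only [halvesOn, ofPred_and, ofPred_forall]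
  refine IsClosed.inter (isClosed_iInter fun x => isClosed_iInter fun _ =>
    isClosed_eq (hev x) continuous_const) (isClosed_iInter fun x => IsClosed.inter ?_ ?_)
  · exact isClosed_le continuous_const (continuous_snd.comp (hev x))
  · exact isClosed_le (continuous_snd.comp (hev x)) continuous_const

/-- The reflection `g ↦ f - g` is an isometry, so this symmetry transfers density statements from
one summand to the other. -/
theorem sub_mem_halvesOn {f g : C(Icc a b, ℝ × ℝ)} {E : Set (Icc a b)} (hg : g ∈ halvesOn f E) :
    f - g ∈ halvesOn f E := by
  refine ⟨fun x hx => ?_, fun x => ?_⟩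
  · rw [ContinuousMap.sub_apply, hg.1 x hx]
    module
  · have := hg.2 x
    simp only [ContinuousMap.sub_apply, Prod.snd_sub]
    constructor <;> linarith

/-- Elements of `halvesOn f E` are uniform limits of elements whose graph over a given closed set
disjoint from `E` has dimension at most one. -/
theorem exists_mem_halvesOn_dist_lt {f g : C(Icc a b, ℝ × ℝ)} {E K : Set (Icc a b)}
    (hg : g ∈ halvesOn f E) (hE : IsClosed E) (hK : IsClosed K) (hEK : Disjoint E K) {ε : ℝ}
    (hε : 0 < ε) :
    ∃ g' ∈ halvesOn f E, dist g' g < ε ∧ dimH ((fun x => (x, g' x)) '' K) ≤ 1 := by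
  obtain ⟨χ, hχE, hχK, hχ⟩ := exists_continuous_zero_one_of_isClosed hE hK hEK
  let g₁ : C(Icc a b, ℝ) := ⟨fun x => (g x).1, by fun_prop⟩
  let g₂ : C(Icc a b, ℝ) := ⟨fun x => (g x).2, by fun_prop⟩
  obtain ⟨p, hp⟩ := exists_polynomial_near_continuousMap a b g₁ (ε / 4) (by positivity)
  obtain ⟨q, hq⟩ := exists_polynomial_near_continuousMap a b g₂ (ε / 4) (by positivity)
  have hp' : ∀ x : Icc a b, |p.eval (x : ℝ) - (g x).1| < ε / 4 := fun x =>
    (ContinuousMap.norm_coe_le_norm _ x).trans_lt hp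
  have hq' : ∀ x : Icc a b, |q.eval (x : ℝ) - (g x).2| < ε / 4 := fun x =>
    (ContinuousMap.norm_coe_le_norm _ x).trans_lt hq
  -- Lowering `q` by its error bound and truncating at 0 keeps the second coordinate in `[0, (g
  -- x).2]`, so the constraints survive approximation.
  let k : C(Icc a b, ℝ × ℝ) :=
    ⟨fun x => (p.eval (x : ℝ), max (q.eval (x : ℝ) - ε / 4) 0), by fun_prop⟩
  have hk2 : ∀ x, 0 ≤ (k x).2 ∧ (k x).2 ≤ (g x).2 := by
    intro x
    have h1 := abs_lt.1 (hq' x)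
    exact ⟨le_max_right _ _, max_le (by linarith) (hg.2 x).1⟩
  have hkg : ∀ x, ‖k x - g x‖ ≤ ε / 2 := by
    intro x
    have h1 := abs_lt.1 (hp' x)
    have h2 := abs_lt.1 (hq' x)
    have h3 := hk2 x
    have h4 : q.eval (x : ℝ) - ε / 4 ≤ (k x).2 := le_max_left _ _
    rw [Prod.norm_def]
    refine max_le ?_ ?_
    · change |p.eval (x : ℝ) - (g x).1| ≤ _
      rw [abs_le]; constructor <;> linarith
    · change |(k x).2 - (g x).2| ≤ _
      rw [abs_le]; constructor <;> linarith
  -- A convex combination: equal to `g` on `E`, to `k` on `K`, and within the constraints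
  -- everywhere.
  let g' : C(Icc a b, ℝ × ℝ) := ⟨fun x => g x + χ x • (k x - g x), by fun_prop⟩
  have hg' : ∀ x, g' x = g x + χ x • (k x - g x) := fun x => rfl
  refine ⟨g', ⟨fun x hx => ?_, fun x => ?_⟩, ?_, ?_⟩
  · rw [hg', hχE hx, Pi.zero_apply, zero_smul, add_zero, hg.1 x hx]
  · have h1 := hk2 x
    have h2 := hg.2 x
    have h3 := hχ x
    simp only [hg', Prod.snd_add, Prod.smul_snd, Prod.snd_sub, smul_eq_mul]
    constructor
    · nlinarith [mul_nonneg h3.1 h1.1, mul_nonneg (sub_nonneg.2 h3.2) h2.1]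
    · nlinarith [mul_nonneg h3.1 (sub_nonneg.2 h1.2)]
  · refine ((ContinuousMap.dist_le (by positivity)).2 fun x => ?_).trans_lt (half_lt_self hε)
    rw [dist_eq_norm, hg', add_sub_cancel_left, norm_smul, Real.norm_of_nonneg (hχ x).1]
    calc χ x * ‖k x - g x‖ ≤ 1 * (ε / 2) :=
          mul_le_mul (hχ x).2 (hkg x) (norm_nonneg _) zero_le_one
      _ = ε / 2 := one_mul _
  -- Truncation is a contraction, so the graph of `k` is a Lipschitz image of part of a smooth
  -- curve.
  · let G : ℝ → ℝ × ℝ × ℝ := fun t => (t, p.eval t, q.eval t)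
    have hpoly : ∀ p : Polynomial ℝ, ContDiff ℝ 1 fun t => p.eval t := fun p => by
      simpa using p.contDiff_aeval (𝕜 := ℝ) (R := ℝ) 1
    have hG : ContDiff ℝ 1 G :=
      contDiff_id.prodMk ((hpoly p).prodMk (hpoly q))
    have h1 : dimH (range G) ≤ 1 := by simpa using hG.dimH_range_le
    refine le_trans (dimH_image_le_of_edist_le (G := fun x : Icc a b => G x) 1 ?_)
      ((dimH_mono ?_).trans h1)
    · intro x hx y hy
      have hxk : g' x = k x := by
        rw [hg', hχK hx, Pi.one_apply, one_smul, add_sub_cancel]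
      have hyk : g' y = k y := by
        rw [hg', hχK hy, Pi.one_apply, one_smul, add_sub_cancel]
      rw [hxk, hyk, ENNReal.coe_one, one_mul, edist_dist, edist_dist]
      refine ENNReal.ofReal_le_ofReal ?_
      simp only [Prod.dist_eq, G, k, ContinuousMap.coe_mk]
      refine max_le_max le_rfl (max_le_max le_rfl ?_)
      rw [Real.dist_eq, Real.dist_eq]
      refine (abs_max_sub_max_le_abs _ _ _).trans (le_of_eq ?_)
      congr 1
      ring
    · rintro _ ⟨x, -, rfl⟩
      exact ⟨_, rfl⟩

theorem exists_mem_halvesOn_mem_smallGraphCover [Nonempty (Icc a b)] {f : C(Icc a b, ℝ × ℝ)}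
    {E K : Set (Icc a b)} (hE : IsClosed E) (hK : IsClosed K) (hEK : Disjoint E K) {s : ℝ≥0}
    (hs : 1 < s) {ε : ℝ≥0∞} (hε : 0 < ε) {g : C(Icc a b, ℝ × ℝ)} (hg : g ∈ halvesOn f E) {δ : ℝ}
    (hδ : 0 < δ) : ∃ g' ∈ halvesOn f E, dist g' g < δ ∧ g' ∈ smallGraphCover K s ε := by
  obtain ⟨g', h1, h2, h3⟩ := exists_mem_halvesOn_dist_lt hg hE hK hEK hδ
  refine ⟨g', h1, h2, mem_smallGraphCover (by exact_mod_cast one_pos.trans hs) hε ?_⟩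
  exact hausdorffMeasure_of_dimH_lt (h3.trans_lt (by exact_mod_cast hs))

/-- A decomposition of `f` into two summands that are halves of `f` on `E` and have graphs of small
dimension off `E`. -/
theorem exists_mem_halvesOn_dimH_le [Nonempty (Icc a b)] {f : C(Icc a b, ℝ × ℝ)}
    (hf : ∀ x, 0 ≤ (f x).2) {E : Set (Icc a b)} (hE : IsClosed E) {s : ℝ≥0} (hs : 1 < s) :
    ∃ g ∈ halvesOn f E, dimH ((fun x => (x, g x)) '' Eᶜ) ≤ s ∧
      dimH ((fun x => (x, (f - g) x)) '' Eᶜ) ≤ s := by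
  -- Dimension is countably stable, so closed pieces of `Eᶜ` suffice; closedness gives both compact
  -- graphs and cutoffs separating from `E`.
  obtain ⟨K, hKc, hKE, hKU, -⟩ := hE.isOpen_compl.exists_iUnion_isClosed
  have hs0 : (0 : ℝ) < s := by exact_mod_cast one_pos.trans hs
  have hdisj : ∀ n, Disjoint E (K n) := fun n => (disjoint_compl_right.mono_right (hKE n))
  have hne : (2⁻¹ : ℝ) • f ∈ halvesOn f E := by
    refine ⟨fun x _ => rfl, fun x => ?_⟩
    have := hf x
    simp only [ContinuousMap.smul_apply, Prod.smul_snd, smul_eq_mul]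
    constructor <;> linarith
  have : CompleteSpace (halvesOn f E) := (isClosed_halvesOn f E).completeSpace_coe
  have : Nonempty (halvesOn f E) := ⟨⟨_, hne⟩⟩
  have hm0 : ∀ m : ℕ, (0 : ℝ≥0∞) < ((m : ℝ≥0∞) + 1)⁻¹ := fun m =>
    ENNReal.inv_pos.2 (ENNReal.add_ne_top.2 ⟨ENNReal.natCast_ne_top m, ENNReal.one_ne_top⟩)
  let O : ℕ × ℕ → Set (halvesOn f E) := fun i =>
    {g | (g : C(Icc a b, ℝ × ℝ)) ∈ smallGraphCover (K i.1) s ((i.2 : ℝ≥0∞) + 1)⁻¹}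
  let O' : ℕ × ℕ → Set (halvesOn f E) := fun i =>
    {g | f - (g : C(Icc a b, ℝ × ℝ)) ∈ smallGraphCover (K i.1) s ((i.2 : ℝ≥0∞) + 1)⁻¹}
  have hO : ∀ i, IsOpen (O i) := fun i =>
    (isOpen_smallGraphCover (hKc i.1) _ _).preimage continuous_subtype_val
  have hO' : ∀ i, IsOpen (O' i) := fun i =>
    (isOpen_smallGraphCover (hKc i.1) _ _).preimage (continuous_const.sub continuous_subtype_val)
  have hOd : ∀ i, Dense (O i) := by
    refine fun i => Metric.dense_iff.2 fun g δ hδ => ?_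
    obtain ⟨g', h1, h2, h3⟩ := exists_mem_halvesOn_mem_smallGraphCover hE (hKc i.1) (hdisj i.1) hs
      (hm0 i.2) g.2 hδ
    exact ⟨⟨g', h1⟩, h2, h3⟩
  have hOd' : ∀ i, Dense (O' i) := by
    refine fun i => Metric.dense_iff.2 fun g δ hδ => ?_
    obtain ⟨g', h1, h2, h3⟩ := exists_mem_halvesOn_mem_smallGraphCover hE (hKc i.1) (hdisj i.1) hs
      (hm0 i.2) (sub_mem_halvesOn g.2) hδ
    refine ⟨⟨f - g', sub_mem_halvesOn h1⟩, ?_, ?_⟩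
    · have h4 : dist (f - g') (f - (f - (g : C(Icc a b, ℝ × ℝ)))) < δ := by
        rwa [dist_sub_left]
      rwa [sub_sub_cancel] at h4
    · have h4 : f - (f - g') ∈ smallGraphCover (K i.1) s ((i.2 : ℝ≥0∞) + 1)⁻¹ := by
        rwa [sub_sub_cancel]
      exact h4
  obtain ⟨g, hg⟩ := (dense_iInter_of_isOpen (fun i => (hO i).inter (hO' i))
    fun i => (hOd i).inter_of_isOpen_left (hOd' i) (hO i)).nonempty
  rw [mem_iInter] at hg
  refine ⟨g, g.2, ?_, ?_⟩
  · rw [← hKU, image_iUnion, dimH_iUnion]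
    refine iSup_le fun n => dimH_le_of_hausdorffMeasure_ne_top ?_
    rw [hausdorffMeasure_graph_eq_zero hs0 fun m => (hg (n, m)).1]
    exact ENNReal.zero_ne_top
  · rw [← hKU, image_iUnion, dimH_iUnion]
    refine iSup_le fun n => dimH_le_of_hausdorffMeasure_ne_top ?_
    rw [hausdorffMeasure_graph_eq_zero hs0 fun m => (hg (n, m)).2]
    exact ENNReal.zero_ne_top

end Decomposition

/-! ### Intervals: metric sums and planar coordinates. -/

theorem infDist_eq_abs_sub {S : Set ℝ} {p q : ℝ} (hp : p ∈ S) (h : ∀ p' ∈ S, |q - p| ≤ |q - p'|) :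
    Metric.infDist q S = |q - p| :=
  le_antisymm (Metric.infDist_le_dist_of_mem hp) ((Metric.le_infDist ⟨p, hp⟩).2 fun p' hp' => h p' hp')

/-- The metric sum of two compact intervals is their Minkowski sum. -/
theorem metricSum_Icc {l u l' u' : ℝ} (h : l ≤ u) (h' : l' ≤ u') :
    metricSum (Icc l u) (Icc l' u') = Icc (l + l') (u + u') := by
  apply Subset.antisymm
  · rintro _ ⟨⟨p, q⟩, ⟨hp, hq, -⟩, rfl⟩
    exact ⟨add_le_add hp.1 hq.1, add_le_add hp.2 hq.2⟩
  · rintro z ⟨hz, hz'⟩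
    suffices H : ∃ p ∈ Icc l u, z - p ∈ Icc l' u' ∧
        (Metric.infDist (z - p) (Icc l u) = |(z - p) - p| ∨
          Metric.infDist p (Icc l' u') = |p - (z - p)|) by
      obtain ⟨p, hp, hq, hpq⟩ := H
      exact ⟨(p, z - p), ⟨hp, hq, hpq⟩, add_sub_cancel p z⟩
    -- The admissible `p` form `[max l (z - u'), min u (z - l')]`; take the one nearest to `z / 2`.
    -- Either `p = z - p`, or one of the two is the endpoint of its interval facing the other.
    rcases lt_or_ge (z / 2) (max l (z - u')) with h1 | h1
    · rcases le_total l (z - u') with h2 | h2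
      · rw [max_eq_right h2] at h1
        refine ⟨z - u', ⟨h2, by linarith⟩, ⟨by linarith, by linarith⟩, Or.inr ?_⟩
        rw [sub_sub_cancel]
        refine infDist_eq_abs_sub ⟨h', le_rfl⟩ fun q hq => ?_
        rw [abs_of_pos (by linarith), abs_of_pos (by linarith [hq.2])]
        linarith [hq.2]
      · rw [max_eq_left h2] at h1
        refine ⟨l, ⟨le_rfl, h⟩, ⟨by linarith, by linarith⟩, Or.inl ?_⟩
        refine infDist_eq_abs_sub ⟨le_rfl, h⟩ fun q hq => ?_
        rw [abs_of_neg (by linarith), abs_of_neg (by linarith [hq.1])]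
        linarith [hq.1]
    rw [max_le_iff] at h1
    rcases lt_or_ge (min u (z - l')) (z / 2) with h3 | h3
    · rcases le_total u (z - l') with h2 | h2
      · rw [min_eq_left h2] at h3
        refine ⟨u, ⟨h, le_rfl⟩, ⟨by linarith, by linarith⟩, Or.inl ?_⟩
        refine infDist_eq_abs_sub ⟨h, le_rfl⟩ fun q hq => ?_
        rw [abs_of_pos (by linarith), abs_of_pos (by linarith [hq.2])]
        linarith [hq.2]
      · rw [min_eq_right h2] at h3
        refine ⟨z - l', ⟨by linarith, h2⟩, ⟨by linarith, by linarith⟩, Or.inr ?_⟩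
        rw [sub_sub_cancel]
        refine infDist_eq_abs_sub ⟨le_rfl, h'⟩ fun q hq => ?_
        rw [abs_of_neg (by linarith), abs_of_neg (by linarith [hq.1])]
        linarith [hq.1]
    rw [le_min_iff] at h3
    refine ⟨z / 2, ⟨h1.1, h3.1⟩, ⟨by linarith, by linarith⟩, Or.inl ?_⟩
    rw [sub_half, sub_self, abs_zero]
    exact Metric.infDist_zero_of_mem ⟨h1.1, h3.1⟩

/-- The interval `[v₁, v₁ + v₂]` as a convex compact set. -/
def convexCompactsIcc (v : ℝ × ℝ) (hv : 0 ≤ v.2) : ConvexCompacts :=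
  ⟨⟨⟨Icc v.1 (v.1 + v.2), isCompact_Icc⟩, nonempty_Icc.2 (le_add_of_nonneg_right hv)⟩,
    convex_Icc _ _⟩

theorem nonemptyCompacts_dist_le_of_coe_eq_Icc {A B : NonemptyCompacts ℝ} {v w : ℝ × ℝ} (hv : 0 ≤ v.2)
    (hw : 0 ≤ w.2) (hA : (A : Set ℝ) = Icc v.1 (v.1 + v.2))
    (hB : (B : Set ℝ) = Icc w.1 (w.1 + w.2)) : dist A B ≤ 2 * dist v w := by
  rw [Metric.NonemptyCompacts.dist_eq, hA, hB]
  have key : ∀ v w : ℝ × ℝ, 0 ≤ w.2 → ∀ x ∈ Icc v.1 (v.1 + v.2),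
      ∃ y ∈ Icc w.1 (w.1 + w.2), dist x y ≤ 2 * dist v w := by
    intro v w hw x hx
    have h1 : |v.1 - w.1| ≤ dist v w := (le_max_left _ _ : dist v.1 w.1 ≤ dist v w)
    have h2 : |v.2 - w.2| ≤ dist v w := (le_max_right _ _ : dist v.2 w.2 ≤ dist v w)
    rw [abs_le] at h1 h2
    have h3 := hx.1
    have h4 := hx.2
    rcases lt_or_ge x w.1 with h | h
    · refine ⟨w.1, ⟨le_rfl, by linarith⟩, ?_⟩
      rw [Real.dist_eq, abs_le]; constructor <;> linarith
    · rcases lt_or_ge (w.1 + w.2) x with h' | h'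
      · refine ⟨w.1 + w.2, ⟨by linarith, le_rfl⟩, ?_⟩
        rw [Real.dist_eq, abs_le]; constructor <;> linarith
      · exact ⟨x, ⟨h, h'⟩, by rw [dist_self]; positivity⟩
  exact Metric.hausdorffDist_le_of_mem_dist (by positivity) (key v w hw) fun x hx => by
    rw [dist_comm v w]; exact key w v hv x hx

/-- Each endpoint moves by at most the Hausdorff distance; the length, a difference of endpoints,
accounts for the factor 2. -/
theorem dist_le_nonemptyCompacts_dist_of_coe_eq_Icc {A B : NonemptyCompacts ℝ} {v w : ℝ × ℝ} (hv : 0 ≤ v.2)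
    (hw : 0 ≤ w.2) (hA : (A : Set ℝ) = Icc v.1 (v.1 + v.2))
    (hB : (B : Set ℝ) = Icc w.1 (w.1 + w.2)) : dist v w ≤ 2 * dist A B := by
  have fin : ∀ A B : NonemptyCompacts ℝ, Metric.hausdorffEDist (A : Set ℝ) B ≠ ⊤ := fun A B =>
    Metric.hausdorffEDist_ne_top_of_nonempty_of_bounded A.nonempty B.nonempty
      A.isCompact.isBounded B.isCompact.isBounded
  have key : ∀ A B : NonemptyCompacts ℝ, ∀ x ∈ (A : Set ℝ), ∃ y ∈ (B : Set ℝ),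
      |x - y| ≤ dist A B := by
    intro A B x hx
    obtain ⟨y, hy, hxy⟩ := B.isCompact.exists_infDist_eq_dist B.nonempty x
    refine ⟨y, hy, ?_⟩
    rw [← Real.dist_eq, ← hxy, Metric.NonemptyCompacts.dist_eq]
    exact Metric.infDist_le_hausdorffDist_of_mem hx (fin A B)
  obtain ⟨y₁, hy₁, h₁⟩ := key A B v.1 (by rw [hA]; exact ⟨le_rfl, by linarith⟩)
  obtain ⟨y₂, hy₂, h₂⟩ := key A B (v.1 + v.2) (by rw [hA]; exact ⟨by linarith, le_rfl⟩)
  obtain ⟨y₃, hy₃, h₃⟩ := key B A w.1 (by rw [hB]; exact ⟨le_rfl, by linarith⟩)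
  obtain ⟨y₄, hy₄, h₄⟩ := key B A (w.1 + w.2) (by rw [hB]; exact ⟨by linarith, le_rfl⟩)
  rw [hB] at hy₁ hy₂
  rw [hA] at hy₃ hy₄
  rw [dist_comm] at h₃ h₄
  rw [abs_le] at h₁ h₂ h₃ h₄
  refine max_le ?_ ?_
  · rw [Real.dist_eq, abs_le]
    constructor <;> linarith [hy₁.1, hy₃.1, h₁.1, h₁.2, h₃.1, h₃.2]
  · rw [Real.dist_eq, abs_le]
    constructor <;>
      linarith [hy₁.1, hy₃.1, h₁.1, h₁.2, h₃.1, h₃.2, hy₂.2, hy₄.2, h₂.1, h₂.2, h₄.1, h₄.2]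

theorem exists_continuousMap_coe_eq_Icc {a b : ℝ} (f : C(Icc a b, ConvexCompacts)) :
    ∃ φ : C(Icc a b, ℝ × ℝ), (∀ x, 0 ≤ (φ x).2) ∧
      ∀ x, ((f x).1 : Set ℝ) = Icc (φ x).1 ((φ x).1 + (φ x).2) := by
  have H : ∀ x, ∃ v : ℝ × ℝ, 0 ≤ v.2 ∧ ((f x).1 : Set ℝ) = Icc v.1 (v.1 + v.2) := by
    intro x
    have h := eq_Icc_of_connected_compact ((f x).2.isConnected (f x).1.nonempty) (f x).1.isCompact
    refine ⟨(sInf ((f x).1 : Set ℝ), sSup ((f x).1 : Set ℝ) - sInf ((f x).1 : Set ℝ)), ?_, ?_⟩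
    · have h1 := (f x).1.nonempty
      rw [h, nonempty_Icc] at h1
      exact sub_nonneg.2 h1
    · rw [add_sub_cancel]; exact h
  choose φ hφ hφf using H
  refine ⟨⟨φ, continuous_iff_continuousAt.2 fun x => ?_⟩, hφ, hφf⟩
  refine tendsto_iff_dist_tendsto_zero.2 (squeeze_zero (fun _ => dist_nonneg)
    (fun y => dist_le_nonemptyCompacts_dist_of_coe_eq_Icc (hφ y) (hφ x) (hφf y) (hφf x)) ?_)
  have h1 := (tendsto_iff_dist_tendsto_zero.1 (f.continuous.tendsto x)).const_mul 2
  rw [mul_zero] at h1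
  exact h1

theorem exists_continuousMap_coe_eq_Icc_of_nonneg {a b : ℝ} (φ : C(Icc a b, ℝ × ℝ))
    (hφ : ∀ x, 0 ≤ (φ x).2) :
    ∃ f : C(Icc a b, ConvexCompacts),
      ∀ x, ((f x).1 : Set ℝ) = Icc (φ x).1 ((φ x).1 + (φ x).2) := by
  refine ⟨⟨fun x => convexCompactsIcc (φ x) (hφ x), continuous_iff_continuousAt.2 fun x => ?_⟩,
    fun x => rfl⟩
  refine tendsto_iff_dist_tendsto_zero.2 (squeeze_zero (fun _ => dist_nonneg)
    (fun y => nonemptyCompacts_dist_le_of_coe_eq_Icc (hφ y) (hφ x) rfl rfl) ?_)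
  have h1 := (tendsto_iff_dist_tendsto_zero.1 (φ.continuous.tendsto x)).const_mul 2
  rw [mul_zero] at h1
  exact h1

theorem edist_le_of_dist_le {X Y : Type*} [PseudoMetricSpace X] [PseudoMetricSpace Y] {p q : X}
    {p' q' : Y} {C : ℝ≥0} (h : dist p q ≤ C * dist p' q') : edist p q ≤ C * edist p' q' := by
  rw [edist_dist, edist_dist, ← ENNReal.ofReal_coe_nnreal, ← ENNReal.ofReal_mul C.coe_nonneg]
  exact ENNReal.ofReal_le_ofReal h

theorem dimH_svfGraph {a b : ℝ} {f : Icc a b → ConvexCompacts} {φ : Icc a b → ℝ × ℝ}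
    (hφ : ∀ x, 0 ≤ (φ x).2)
    (hf : ∀ x, ((f x).1 : Set ℝ) = Icc (φ x).1 ((φ x).1 + (φ x).2)) :
    dimH (svfGraph f) = dimH (range fun x => (x, φ x)) := by
  have hedist : ∀ x y, edist (WithLp.toLp 1 (x, (f x).1)) (WithLp.toLp 1 (y, (f y).1)) =
      edist x y + edist (f x).1 (f y).1 := fun x y =>
    (WithLp.prod_edist_eq_add (by simp) _ _).trans (by simp)
  rw [svfGraph, ← image_univ, ← image_univ]
  apply le_antisymm
  · refine dimH_image_le_of_edist_le 3 fun x _ y _ => ?_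
    rw [hedist]
    have h1 : edist (f x).1 (f y).1 ≤ (2 : ℝ≥0) * edist (φ x) (φ y) :=
      edist_le_of_dist_le (nonemptyCompacts_dist_le_of_coe_eq_Icc (hφ x) (hφ y) (hf x) (hf y))
    calc edist x y + edist (f x).1 (f y).1
        ≤ edist (x, φ x) (y, φ y) + (2 : ℝ≥0) * edist (x, φ x) (y, φ y) := by
          refine add_le_add (le_max_left _ _) (h1.trans ?_)
          gcongr
          exact le_max_right _ _
      _ = (3 : ℝ≥0) * edist (x, φ x) (y, φ y) := by
          push_cast
          ring
  · refine dimH_image_le_of_edist_le 2 fun x _ y _ => ?_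
    rw [hedist, mul_add]
    refine max_le (le_add_right ?_) (le_add_left ?_)
    · exact le_mul_of_one_le_left' (by norm_num)
    · exact edist_le_of_dist_le (dist_le_nonemptyCompacts_dist_of_coe_eq_Icc (hφ x) (hφ y) (hf x) (hf y))

/-! ### Choice of `E` and conclusion. -/

/-- A graph of dimension at least `β` has dimension exactly `β` over some closed set. -/
theorem exists_isClosed_dimH_graph_eq {a b : ℝ} (φ : C(Icc a b, ℝ × ℝ)) {β : ℝ≥0} (hβ : 0 < β)
    (h : β ≤ dimH (range fun x => (x, φ x))) :
    ∃ E : Set (Icc a b), IsClosed E ∧ dimH ((fun x => (x, φ x)) '' E) = β := by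
  -- Equality is separate: positive content needs infinite `β`-measure, which only a strict
  -- inequality guarantees.
  rcases h.eq_or_lt with h | h
  · exact ⟨univ, isClosed_univ, by rw [image_univ, h]⟩
  -- `R` bounds all three coordinates of the graph, so the similarity `e` carries it into the unit
  -- cube.
  let R : ℝ≥0 := ‖a‖₊ + ‖b‖₊ + ‖φ‖₊ + 1
  have hR : 0 < R := by positivity
  have hR' : (0 : ℝ) < R := by exact_mod_cast hR
  have hRdef : (R : ℝ) = |a| + |b| + ‖φ‖ + 1 := by simp [R]
  let e : ℝ → ℝ := fun t => (t + R) / (2 * R)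
  have he : ∀ s t, dist (e s) (e t) = dist s t / (2 * R) := fun s t => by
    simp only [e, Real.dist_eq]
    rw [← sub_div, add_sub_add_right_eq_sub, abs_div, abs_of_pos (by positivity : (0 : ℝ) < 2 * R)]
  have he01 : ∀ t : ℝ, |t| ≤ R → e t ∈ Icc (0 : ℝ) 1 := fun t ht => by
    rw [abs_le] at ht
    exact ⟨div_nonneg (by linarith) (by positivity), (div_le_one (by positivity)).2 (by linarith)⟩
  have hec : Continuous e := by fun_prop
  let F : Icc a b → Fin 3 → ℝ := fun x => ![e x, e (φ x).1, e (φ x).2]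
  have hF : Continuous F := by
    refine continuous_pi fun j => ?_
    fin_cases j
    · exact hec.comp continuous_subtype_val
    · exact hec.comp (continuous_fst.comp φ.continuous)
    · exact hec.comp (continuous_snd.comp φ.continuous)
  have hF01 : ∀ x j, F x j ∈ Icc (0 : ℝ) 1 := by
    intro x j
    have h1 : ‖φ x‖ ≤ ‖φ‖ := φ.norm_coe_le_norm x
    have h2 := abs_nonneg a
    have h3 := abs_nonneg b
    have h4 := norm_nonneg φ
    fin_cases j
    · refine he01 _ (abs_le.2 ⟨?_, ?_⟩)
      · linarith [x.2.1, neg_abs_le a]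
      · linarith [x.2.2, le_abs_self b]
    · refine he01 _ (((le_max_left _ _ : |(φ x).1| ≤ ‖φ x‖)).trans (h1.trans ?_))
      linarith
    · refine he01 _ (((le_max_right _ _ : |(φ x).2| ≤ ‖φ x‖)).trans (h1.trans ?_))
      linarith
  have hdist : ∀ x y, dist (F x) (F y) = dist (x, φ x) (y, φ y) / (2 * R) := by
    intro x y
    apply le_antisymm
    · refine (dist_pi_le_iff (by positivity)).2 fun j => ?_
      fin_cases j
      · refine (he _ _).trans_le ?_
        gcongr
        exact le_max_left _ _
      · refine (he _ _).trans_le ?_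
        gcongr
        exact (le_max_left _ _).trans (le_max_right _ _)
      · refine (he _ _).trans_le ?_
        gcongr
        exact (le_max_right _ _).trans (le_max_right _ _)
    · rw [div_le_iff₀ (by positivity)]
      have hj : ∀ j s t, F x j = e s → F y j = e t → dist s t ≤ dist (F x) (F y) * (2 * R) := by
        intro j s t hs ht
        rw [← div_le_iff₀ (by positivity), ← he, ← hs, ← ht]
        exact dist_le_pi_dist _ _ j
      exact max_le (hj 0 _ _ rfl rfl) (max_le (hj 1 _ _ rfl rfl) (hj 2 _ _ rfl rfl))
  have hle : ∀ S : Set (Icc a b), dimH ((fun x => (x, φ x)) '' S) = dimH (F '' S) := by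
    intro S
    apply le_antisymm
    · refine dimH_image_le_of_edist_le (2 * R) fun x _ y _ => edist_le_of_dist_le ?_
      rw [hdist]
      push_cast
      rw [mul_div_cancel₀ _ (by positivity)]
    · refine dimH_image_le_of_edist_le (2 * R)⁻¹ fun x _ y _ => edist_le_of_dist_le ?_
      rw [hdist]
      push_cast
      rw [div_eq_inv_mul]
  rw [← image_univ, hle, image_univ] at h
  obtain ⟨E, hE, hEβ⟩ := exists_isClosed_dimH_image_eq hF hF01 hβ h
  exact ⟨E, hE, by rw [hle, hEβ]⟩

/-- Halving the values is bi-Lipschitz on graphs, so the part over `E` has dimension exactly `β`,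
and the rest cannot exceed it. -/
theorem dimH_graph_eq_of_mem_halvesOn {a b : ℝ} {φ g : C(Icc a b, ℝ × ℝ)} {E : Set (Icc a b)}
    {β : ℝ≥0} (hE : dimH ((fun x => (x, φ x)) '' E) = β) (hg : g ∈ halvesOn φ E)
    (hc : dimH ((fun x => (x, g x)) '' Eᶜ) ≤ β) : dimH (range fun x => (x, g x)) = β := by
  have h1 : dimH ((fun x => (x, g x)) '' E) = β := by
    have hd : ∀ x ∈ E, ∀ y ∈ E, dist (g x) (g y) = 2⁻¹ * dist (φ x) (φ y) := fun x hx y hy => by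
      rw [hg.1 x hx, hg.1 y hy, dist_smul₀, Real.norm_of_nonneg (by norm_num)]
    have hgr : ∀ (ψ : C(Icc a b, ℝ × ℝ)) x y,
        dist (x, ψ x) (y, ψ y) = max (dist x y) (dist (ψ x) (ψ y)) := fun ψ x y => rfl
    rw [← hE]
    apply le_antisymm
    · refine dimH_image_le_of_edist_le 1 fun x hx y hy => edist_le_of_dist_le ?_
      rw [NNReal.coe_one, one_mul, hgr, hgr, hd x hx y hy]
      exact max_le_max le_rfl (by linarith [dist_nonneg (x := φ x) (y := φ y)])
    · refine dimH_image_le_of_edist_le 2 fun x hx y hy => edist_le_of_dist_le ?_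
      rw [NNReal.coe_ofNat, hgr, hgr, hd x hx y hy]
      refine max_le ?_ ?_
      · linarith [le_max_left (dist x y) (2⁻¹ * dist (φ x) (φ y)), dist_nonneg (x := x) (y := y)]
      · linarith [le_max_right (dist x y) (2⁻¹ * dist (φ x) (φ y))]
  rw [← image_univ, ← union_compl_self E, image_union, dimH_union, h1, max_eq_left hc]

theorem mainTheorem3 (a b : ℝ) (hab : a < b) (f : C(Icc a b, ConvexCompacts)) (β : ℝ)
    (hβ : 1 < β) (hf : ENNReal.ofReal β ≤ dimH (svfGraph f)) :
    ∃ g ∈ dimClass a b β, ∃ h ∈ dimClass a b β,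
      ∀ x : Icc a b, ((f x).1 : Set ℝ) = metricSum ((g x).1 : Set ℝ) ((h x).1 : Set ℝ) := by
  have : Nonempty (Icc a b) := ⟨⟨a, le_rfl, hab.le⟩⟩
  have hβ1 : 1 < β.toNNReal := by rwa [← NNReal.coe_lt_coe, Real.coe_toNNReal _ (by linarith)]
  obtain ⟨φ, hφ, hfφ⟩ := exists_continuousMap_coe_eq_Icc f
  rw [dimH_svfGraph hφ hfφ] at hf
  obtain ⟨E, hE, hEβ⟩ := exists_isClosed_dimH_graph_eq φ (one_pos.trans hβ1) hf
  obtain ⟨γ, hγ, hγ1, hγ2⟩ := exists_mem_halvesOn_dimH_le hφ hE hβ1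
  have hη := sub_mem_halvesOn hγ
  have hγ0 : ∀ x, 0 ≤ (γ x).2 := fun x => (hγ.2 x).1
  have hη0 : ∀ x, 0 ≤ ((φ - γ) x).2 := fun x => (hη.2 x).1
  obtain ⟨g, hg⟩ := exists_continuousMap_coe_eq_Icc_of_nonneg γ hγ0
  obtain ⟨h, hh⟩ := exists_continuousMap_coe_eq_Icc_of_nonneg (φ - γ) hη0
  refine ⟨g, (dimH_svfGraph hγ0 hg).trans (dimH_graph_eq_of_mem_halvesOn hEβ hγ hγ1),
    h, (dimH_svfGraph hη0 hh).trans (dimH_graph_eq_of_mem_halvesOn hEβ hη hγ2), fun x => ?_⟩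
  rw [hfφ, hg, hh, metricSum_Icc (le_add_of_nonneg_right (hγ0 x))
    (le_add_of_nonneg_right (hη0 x))]
  simp only [ContinuousMap.sub_apply, Prod.fst_sub, Prod.snd_sub]
  congr 1 <;> ring
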